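/- A staircase tableau of size $n$ is a filling of the Young diagram of shape $(n,n-1,\dots,1)$ in which each box is empty or labeled by $\alpha,\beta,\gamma$ or $\delta$, such that no box on the diagonal (the last boxes of the rows) is empty, all boxes in the same row and to the left of a $\beta$ or $\delta$ are empty, and all boxes in the same column and above an $\alpha$ or $\gamma$ are empty. Fill each empty box as follows, where it "sees" to its right (respectively below it) the label of the closest labeled box to its right in its row (respectively below it in its column): with $1$ if it sees $\beta$ to its right; with $q$ if it sees $\delta$ to its right; with $1$ if it sees $\alpha$ or $\gamma$ to its right and $\alpha$ or $\delta$ below it; with $q$ if it sees $\alpha$ or $\gamma$ to its right and $\beta$ or $\gamma$ below it. The weight $\mathrm{wt}(\mathcal T)$ is the product of the entries of all boxes, and $t(\mathcal T)$ is the number of diagonal boxes labeled $\alpha$ or $\delta$. Put $$Z_n(y;\alpha,\beta,\gamma,\delta;q)=\sum_{\mathcal T\text{ of size }n}\mathrm{wt}(\mathcal T)\,y^{t(\mathcal T)}.$$ Let $\alpha=\beta=\gamma=\delta=1$, $q=0$, and let $Z_n(y)=Z_n(y;1,1,1,1;0)$. Then, as formal power series in $t$ (with $y$ an indeterminate, or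 any element of a commutative ring), $$\sum_{n\ge 1} Z_n(y)\,w^n=\frac{2(1+y)\,t\,(1+t)(1+yt)}{(1-t-t^2)(1-yt-y^2t^2)},\qquad\text{where } w=\frac{t}{(1+t)(1+yt)}.$$ Moreover, $Z_n(0)=2F_{2n}$ for all $n\ge 1$, where $F_0=0$, $F_1=1$, $F_{m+1}=F_m+F_{m-1}$ are the Fibonacci numbers. -/

import Mathlib

/-- The four letters that may label a box of a staircase tableau. -/
inductive Label where
  | al
  | be
  | ga
  | de
  deriving DecidableEq

instance : Fintype Label :=
  ⟨{Label.al, Label.be, Label.ga, Label.de}, by intro l; cases l <;> simp⟩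

/-- The boxes of the Young diagram of staircase shape `(n, n - 1, …, 2, 1)`. Rows are numbered
from top to bottom and columns from left to right, both starting at `0`; row `i` has `n - i`
boxes. -/
abbrev Box (n : ℕ) : Type := {p : Fin n × Fin n // (p.1 : ℕ) + (p.2 : ℕ) < n}

namespace Box

variable {n : ℕ}

/-- The row of a box. -/
def row (b : Box n) : Fin n := b.1.1

/-- The column of a box. -/
def col (b : Box n) : Fin n := b.1.2

/-- The diagonal box of row `i`, which is the last box of that row. -/
def diag (i : Fin n) : Box n :=
  ⟨(i, i.rev), by have := i.isLt; simp only [Fin.val_rev]; omega⟩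

end Box

/-- A filling of the staircase shape: a box is empty (`none`) or carries a label. -/
abbrev Filling (n : ℕ) : Type := Box n → Option Label

/-- The conditions that make a filling a staircase tableau. -/
def IsStaircaseTableau {n : ℕ} (T : Filling n) : Prop :=
  (∀ i : Fin n, T (Box.diag i) ≠ none) ∧
  (∀ b b' : Box n, (T b = some Label.be ∨ T b = some Label.de) →
    b'.row = b.row → b'.col < b.col → T b' = none) ∧
  (∀ b b' : Box n, (T b = some Label.al ∨ T b = some Label.ga) →
    b'.col = b.col → b'.row < b.row → T b' = none)

instance {n : ℕ} (T : Filling n) : Decidable (IsStaircaseTableau T) := by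
  unfold IsStaircaseTableau; infer_instance

/-- Staircase tableaux of size `n`. -/
abbrev StaircaseTableau (n : ℕ) : Type := {T : Filling n // IsStaircaseTableau T}

/-- The closest labeled box to the right of `b` in the same row exists and has label `l`. -/
def SeesRight {n : ℕ} (T : Filling n) (b : Box n) (l : Label) : Prop :=
  ∃ b' : Box n, b'.row = b.row ∧ b.col < b'.col ∧ T b' = some l ∧
    ∀ c : Box n, c.row = b.row → b.col < c.col → c.col < b'.col → T c = none

instance {n : ℕ} (T : Filling n) (b : Box n) (l : Label) : Decidable (SeesRight T b l) := by
  unfold SeesRight; infer_instance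

/-- The closest labeled box below `b` in the same column exists and has label `l`. -/
def SeesBelow {n : ℕ} (T : Filling n) (b : Box n) (l : Label) : Prop :=
  ∃ b' : Box n, b'.col = b.col ∧ b.row < b'.row ∧ T b' = some l ∧
    ∀ c : Box n, c.col = b.col → b.row < c.row → c.row < b'.row → T c = none

instance {n : ℕ} (T : Filling n) (b : Box n) (l : Label) : Decidable (SeesBelow T b l) := by
  unfold SeesBelow; infer_instance

section Weight

variable {R : Type*} [CommSemiring R]

/-- The letter `q` or `u` assigned to a blank box `b`. In a staircase tableau every blank box lies
off the diagonal, hence sees a label to its right and a label below it, and so exactly one of the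
four cases applies; the final value `1` is never used. -/
def blankWeight {n : ℕ} (T : Filling n) (b : Box n) (q u : R) : R :=
  if SeesRight T b Label.be then u
  else if SeesRight T b Label.de then q
  else if (SeesRight T b Label.al ∨ SeesRight T b Label.ga) ∧
      (SeesBelow T b Label.al ∨ SeesBelow T b Label.de) then u
  else if (SeesRight T b Label.al ∨ SeesRight T b Label.ga) ∧
      (SeesBelow T b Label.be ∨ SeesBelow T b Label.ga) then q
  else 1

/-- The letter in a box after all blank boxes have been filled with `q` or `u`. -/
def boxWeight {n : ℕ} (T : Filling n) (α β γ δ q u : R) (b : Box n) : R :=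
  match T b with
  | some Label.al => α
  | some Label.be => β
  | some Label.ga => γ
  | some Label.de => δ
  | none => blankWeight T b q u

/-- The weight `wt(T)`, the product of the letters in all boxes. -/
def weight {n : ℕ} (T : StaircaseTableau n) (α β γ δ q u : R) : R :=
  ∏ b : Box n, boxWeight T.1 α β γ δ q u b

/-- The type of a tableau, as a word of length `n` read along the diagonal from northeast to
southwest: the letter is `true` (a black particle) if the diagonal box is labeled `α` or `δ`, and
`false` (a hole) if it is labeled `β` or `γ`. -/
def tableauType {n : ℕ} (T : StaircaseTableau n) (i : Fin n) : Bool :=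
  decide (T.1 (Box.diag i) = some Label.al ∨ T.1 (Box.diag i) = some Label.de)

/-- `t(T)`, the number of black particles in the type of `T`. -/
def particleCount {n : ℕ} (T : StaircaseTableau n) : ℕ :=
  (Finset.univ.filter fun i : Fin n => tableauType T i = true).card

/-- The fugacity partition function `Z_n(y; α, β, γ, δ; q)`, the sum of `wt(T) y ^ t(T)` over all
staircase tableaux `T` of size `n`, with `u = 1`. -/
def fugacityZ (n : ℕ) (y α β γ δ q : R) : R :=
  ∑ T : StaircaseTableau n, weight T α β γ δ q 1 * y ^ particleCount T

end Weight

/-- The quotient `f / g` of formal power series, for `g` with constant coefficient `1`. -/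
noncomputable def seriesQuot {R : Type*} [CommRing R] (f g : PowerSeries R) : PowerSeries R :=
  f * PowerSeries.invOfUnit g 1

theorem seriesQuot_mul {R : Type*} [CommRing R] (f g : PowerSeries R)
    (hg : PowerSeries.constantCoeff g = 1) : seriesQuot f g * g = f := by
  have h : g * PowerSeries.invOfUnit g 1 = 1 := PowerSeries.mul_invOfUnit g 1 (by simpa using hg)
  rw [seriesQuot, mul_assoc, mul_comm (PowerSeries.invOfUnit g 1) g, h, mul_one]

/-! Build a tableau column by column from right to left. A new first column sees the older columns
only through the leading (leftmost) label of each row. At `q = 0` a row led by `δ` annihilates every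
further column, since the next box must be empty and gets weight `q`. A row led by `β` forces an
empty box of weight `1`. So only the number `k` of open rows, led by `α` or `γ`, matters, and adding
a column without `δ` acts on functions of `k` by the operator `transfer`. The last column added may
contain `δ`; its total weight is the Fibonacci expression `finalTest`. Hence `Z_{n+1}` is the value
at `k = 0` of the `n`-th iterate of `transfer` on `finalTest` (`fugacityZ_succ`), reached through
`columnSum_openTest` and `columnSum_one`.

The series `G_k = ∑ wⁿ transferⁿ(finalTest)(k)` is the only solution of `G = finalTest + w ·
transfer G`, because `w` has no constant term. The substitution for `w` is the kernel method: it
makes `(1 + t)^k` an eigenfunction of `w · transfer` with eigenvalue `1` up to a constant in `k`.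
The ansatz `a F_{2k+1} + b F_{2k+2} + c (1 + t)^k` then solves the equation (`transfer_explicit`,
`subst_iterate_transfer`).

At `y = 0` the formula is the series of `2 F_{2n}` composed with `t / (1 + t)`, which can be
inverted. -/

namespace Box

/-! ### Splitting off the first column of the staircase. -/

variable {n : ℕ}

/-- The box one column further to the right, in the staircase with one more column. -/
def shift (b : Box n) : Box (n + 1) :=
  ⟨(b.1.1.castSucc, b.1.2.succ), by have := b.2; simp only [Fin.val_castSucc, Fin.val_succ]; omega⟩

/-- The box of row `i` in the first column. -/
def first (i : Fin (n + 1)) : Box (n + 1) := ⟨(i, 0), by have := i.isLt; simp only [Fin.val_zero]; omega⟩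

@[simp] theorem row_shift (b : Box n) : b.shift.row = b.row.castSucc := rfl
@[simp] theorem col_shift (b : Box n) : b.shift.col = b.col.succ := rfl
@[simp] theorem row_first (i : Fin (n + 1)) : (first i).row = i := rfl
@[simp] theorem col_first (i : Fin (n + 1)) : (first i).col = 0 := rfl

theorem shift_or_first (b : Box (n + 1)) : (∃ b' : Box n, b = b'.shift) ∨ ∃ i, b = first i := by
  obtain ⟨⟨i, j⟩, h⟩ := b
  induction j using Fin.cases with
  | zero => exact Or.inr ⟨i, rfl⟩
  | succ j =>
    have h' : (i : ℕ) + j < n := by simp only [Fin.val_succ] at h; omega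
    exact Or.inl ⟨⟨(⟨i, by omega⟩, j), h'⟩, rfl⟩

/-- The staircase with `n + 1` columns is the shifted staircase together with a first column. -/
noncomputable def splitEquiv (n : ℕ) : Box n ⊕ Fin (n + 1) ≃ Box (n + 1) :=
  Equiv.ofBijective (Sum.elim shift first) <| by
    constructor
    · rintro (⟨⟨i, j⟩, h⟩ | i) (⟨⟨i', j'⟩, h'⟩ | i') e <;>
        simp [shift, first, Prod.ext_iff, Fin.ext_iff] at e ⊢ <;> omega
    · intro b
      rcases shift_or_first b with ⟨b', rfl⟩ | ⟨i, rfl⟩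
      · exact ⟨Sum.inl b', rfl⟩
      · exact ⟨Sum.inr i, rfl⟩

theorem forall_box {p : Box (n + 1) → Prop} :
    (∀ b, p b) ↔ (∀ b : Box n, p b.shift) ∧ ∀ i, p (first i) := by
  refine ⟨fun h => ⟨fun b => h _, fun i => h _⟩, fun h b => ?_⟩
  rcases shift_or_first b with ⟨b', rfl⟩ | ⟨i, rfl⟩
  exacts [h.1 _, h.2 _]

theorem exists_box {p : Box (n + 1) → Prop} :
    (∃ b, p b) ↔ (∃ b : Box n, p b.shift) ∨ ∃ i, p (first i) := by
  constructor
  · rintro ⟨b, hb⟩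
    rcases shift_or_first b with ⟨b', rfl⟩ | ⟨i, rfl⟩
    exacts [Or.inl ⟨_, hb⟩, Or.inr ⟨_, hb⟩]
  · rintro (⟨b, hb⟩ | ⟨b, hb⟩) <;> exact ⟨_, hb⟩

theorem diag_castSucc (i : Fin n) : diag i.castSucc = (diag i).shift := by
  simp [diag, shift, Fin.ext_iff]; omega

theorem diag_last : diag (Fin.last n) = first (Fin.last n) := by
  simp [diag, first]

end Box

/-! ### What a first column sees: topmost labels, labels below, leading labels of rows. -/

/-- The first label in a finite sequence of possibly empty boxes. -/
def topLabel : {n : ℕ} → (Fin n → Option Label) → Option Label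
  | 0, _ => none
  | _ + 1, c => (c 0).or (topLabel fun i => c i.succ)

/-- The first label strictly after position `i`. -/
def belowLabel : {n : ℕ} → (Fin n → Option Label) → Fin n → Option Label
  | 0, _ => fun i => i.elim0
  | _ + 1, c => Fin.cases (topLabel fun i => c i.succ) (belowLabel fun i => c i.succ)

theorem topLabel_eq_some_iff {n : ℕ} (c : Fin n → Option Label) (l : Label) :
    topLabel c = some l ↔ ∃ j, c j = some l ∧ ∀ k < j, c k = none := by
  induction n with
  | zero => simp [topLabel]
  | succ n ih =>
    rw [topLabel, Fin.exists_fin_succ, Option.or_eq_some_iff, ih]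
    simp [Fin.forall_fin_succ, and_left_comm]

theorem belowLabel_eq_some_iff {n : ℕ} (c : Fin n → Option Label) (i : Fin n) (l : Label) :
    belowLabel c i = some l ↔ ∃ j, i < j ∧ c j = some l ∧ ∀ k, i < k → k < j → c k = none := by
  induction n with
  | zero => exact i.elim0
  | succ n ih =>
    rw [belowLabel]
    induction i using Fin.cases with
    | zero => simp [topLabel_eq_some_iff, Fin.exists_fin_succ, Fin.forall_fin_succ]
    | succ i => simp [ih, Fin.exists_fin_succ, Fin.forall_fin_succ]

/-- Rows with leading labels `s` extended by an additional empty row at the bottom. -/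
def extendLead {n : ℕ} (s : Fin n → Option Label) : Fin (n + 1) → Option Label :=
  fun i => if h : (i : ℕ) < n then s ⟨i, h⟩ else none

@[simp] theorem extendLead_castSucc {n : ℕ} (s : Fin n → Option Label) (i : Fin n) :
    extendLead s i.castSucc = s i := by simp [extendLead]

@[simp] theorem extendLead_last {n : ℕ} (s : Fin n → Option Label) :
    extendLead s (Fin.last n) = none := by simp [extendLead]

theorem extendLead_zero {n : ℕ} (s : Fin (n + 1) → Option Label) :
    extendLead s 0 = s 0 := by simp [extendLead]

theorem extendLead_succ {n : ℕ} (s : Fin (n + 1) → Option Label) (i : Fin (n + 1)) :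
    extendLead s i.succ = extendLead (fun i => s i.succ) i := by simp [extendLead]

/-- The leading labels after a column `c` has been added to the left of rows with leading
labels `s`. -/
def newLead {n : ℕ} (s : Fin n → Option Label) (c : Fin (n + 1) → Option Label) :
    Fin (n + 1) → Option Label :=
  fun i => (c i).or (extendLead s i)

theorem newLead_cons {n : ℕ} (s : Fin n → Option Label) (c : Fin (n + 1) → Option Label)
    (a x : Option Label) :
    newLead (Fin.cons a s : Fin (n + 1) → Option Label)
      (Fin.cons x c : Fin (n + 2) → Option Label) =
      (Fin.cons (x.or a) (newLead s c) : Fin (n + 2) → Option Label) := by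
  funext i
  induction i using Fin.cases with
  | zero => simp [newLead, extendLead_zero]
  | succ i => simp [newLead, extendLead_succ]

/-- A filling without its first column. -/
def restrict {n : ℕ} (T : Filling (n + 1)) : Filling n := fun b => T b.shift

/-- The first column of a filling. -/
def firstCol {n : ℕ} (T : Filling (n + 1)) : Fin (n + 1) → Option Label := fun i => T (Box.first i)

/-- A filling is given by its first column and the rest. -/
noncomputable def fillingEquiv (n : ℕ) :
    Filling (n + 1) ≃ Filling n × (Fin (n + 1) → Option Label) :=
  ((Box.splitEquiv n).symm.arrowCongr (Equiv.refl _)).trans (Equiv.sumArrowEquivProdArrow _ _ _)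

/-- The leading (leftmost) labels of the rows of a filling. -/
def lead : {n : ℕ} → Filling n → Fin n → Option Label
  | 0, _ => fun i => i.elim0
  | _ + 1, T => newLead (lead (restrict T)) (firstCol T)

theorem lead_eq_some_iff {n : ℕ} (T : Filling n) (i : Fin n) (l : Label) :
    lead T i = some l ↔
      ∃ b : Box n, b.row = i ∧ T b = some l ∧ ∀ c : Box n, c.row = i → c.col < b.col → T c = none := by
  induction n with
  | zero => exact i.elim0
  | succ n ih =>
    rw [lead, newLead, Option.or_eq_some_iff, Box.exists_box, or_comm]
    simp only [Box.forall_box, Box.row_shift, Box.col_shift, Box.row_first, Box.col_first]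
    induction i using Fin.lastCases with
    | last => simp [firstCol, Fin.castSucc_ne_last]
    | cast i =>
      simp only [extendLead_castSucc, ih]
      simp [firstCol, restrict, -Subtype.exists, -Subtype.forall, ← and_assoc]
      simp [and_comm, -Subtype.exists, -Subtype.forall]

theorem seesRight_shift {n : ℕ} (T : Filling (n + 1)) (b : Box n) (l : Label) :
    SeesRight T b.shift l ↔ SeesRight (restrict T) b l := by
  rw [SeesRight, SeesRight, Box.exists_box]
  simp [Box.forall_box, restrict, -Subtype.exists, -Subtype.forall]

theorem seesBelow_shift {n : ℕ} (T : Filling (n + 1)) (b : Box n) (l : Label) :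
    SeesBelow T b.shift l ↔ SeesBelow (restrict T) b l := by
  rw [SeesBelow, SeesBelow, Box.exists_box]
  simp [Box.forall_box, restrict, -Subtype.exists, -Subtype.forall, eq_comm (a := (0 : Fin (n + 1)))]

theorem seesRight_first {n : ℕ} (T : Filling (n + 1)) (i : Fin (n + 1)) (l : Label) :
    SeesRight T (Box.first i) l ↔ extendLead (lead (restrict T)) i = some l := by
  rw [SeesRight, Box.exists_box]
  induction i using Fin.lastCases with
  | last => simp [Box.forall_box, -Subtype.exists, -Subtype.forall, Fin.castSucc_ne_last]
  | cast i =>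
    rw [extendLead_castSucc, lead_eq_some_iff]
    simp [Box.forall_box, restrict, -Subtype.exists, -Subtype.forall]

theorem seesBelow_first {n : ℕ} (T : Filling (n + 1)) (i : Fin (n + 1)) (l : Label) :
    SeesBelow T (Box.first i) l ↔ belowLabel (firstCol T) i = some l := by
  rw [SeesBelow, Box.exists_box, belowLabel_eq_some_iff]
  simp [Box.forall_box, firstCol, -Subtype.exists, -Subtype.forall]

/-! ### Which first columns extend a tableau. -/

/-- A first column with labels `c` may be added to rows with leading labels `s`. -/
def ColumnFits {n : ℕ} (s : Fin n → Option Label) (c : Fin (n + 1) → Option Label) : Prop :=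
  c (Fin.last n) ≠ none ∧
  (∀ i, (extendLead s i = some Label.be ∨ extendLead s i = some Label.de) → c i = none) ∧
  (∀ i j, (c i = some Label.al ∨ c i = some Label.ga) → j < i → c j = none)

/-- Everything to the left of a `β` or `δ` is empty, so such a label is automatically the leading
one of its row. This reduces the row condition on a new column to leading labels. -/
theorem lead_eq_be_or_de_iff {n : ℕ} {T : Filling n} (hT : IsStaircaseTableau T) (i : Fin n) :
    (lead T i = some Label.be ∨ lead T i = some Label.de) ↔
      ∃ b : Box n, b.row = i ∧ (T b = some Label.be ∨ T b = some Label.de) := by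
  simp only [lead_eq_some_iff]
  constructor
  · rintro (⟨b, h⟩ | ⟨b, h⟩)
    exacts [⟨b, h.1, Or.inl h.2.1⟩, ⟨b, h.1, Or.inr h.2.1⟩]
  · rintro ⟨b, rfl, h⟩
    have := fun c => hT.2.1 b c h
    rcases h with h | h
    exacts [Or.inl ⟨b, rfl, h, this⟩, Or.inr ⟨b, rfl, h, this⟩]

theorem lead_ne_none {n : ℕ} {T : Filling n} (hT : IsStaircaseTableau T) (i : Fin n) :
    lead T i ≠ none := by
  have key : ∀ m : ℕ, ∀ b : Box n, b.row = i → T b ≠ none → (b.col : ℕ) ≤ m → lead T i ≠ none := by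
    intro m
    induction m using Nat.strong_induction_on with
    | _ m ih =>
      intro b hb hTb hm
      by_cases h : ∀ c : Box n, c.row = i → c.col < b.col → T c = none
      · obtain ⟨l, hl⟩ := Option.ne_none_iff_exists'.1 hTb
        rw [(lead_eq_some_iff T i l).2 ⟨b, hb, hl, h⟩]
        simp
      · push Not at h
        obtain ⟨c, hc, hlt, hTc⟩ := h
        exact ih c.col (lt_of_lt_of_le hlt hm) c hc hTc le_rfl
  exact key _ (Box.diag i) rfl (hT.1 i) le_rfl

theorem isStaircaseTableau_succ_iff {n : ℕ} (T : Filling (n + 1)) :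
    IsStaircaseTableau T ↔
      IsStaircaseTableau (restrict T) ∧ ColumnFits (lead (restrict T)) (firstCol T) := by
  have hrow (hT : IsStaircaseTableau (restrict T)) :
      (∀ i, (extendLead (lead (restrict T)) i = some Label.be ∨
        extendLead (lead (restrict T)) i = some Label.de) → firstCol T i = none) ↔
      ∀ i, ∀ b : Box n, b.row.castSucc = i → (restrict T b = some Label.be ∨
        restrict T b = some Label.de) → firstCol T i = none := by
    refine forall_congr' fun i => ?_
    induction i using Fin.lastCases with
    | last => simp [Fin.castSucc_ne_last]
    | cast i =>
      simp only [extendLead_castSucc, lead_eq_be_or_de_iff hT, Fin.castSucc_inj]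
      simp only [forall_exists_index, and_imp]
  constructor
  · intro h
    have hT : IsStaircaseTableau (restrict T) := by
      refine ⟨fun i => ?_, fun b b' hb hr hc => ?_, fun b b' hb hr hc => ?_⟩
      · rw [restrict, ← Box.diag_castSucc]; exact h.1 _
      · exact h.2.1 b.shift b'.shift hb (by simp [hr]) (by simpa using hc)
      · exact h.2.2 b.shift b'.shift hb (by simp [hr]) (by simpa using hc)
    refine ⟨hT, ?_, (hrow hT).2 ?_, ?_⟩
    · rw [firstCol, ← Box.diag_last]; exact h.1 _
    · rintro _ b rfl hb
      exact h.2.1 b.shift (Box.first _) hb rfl (by simp)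
    · intro i j hi hj
      exact h.2.2 (Box.first i) (Box.first j) hi rfl hj
  · rintro ⟨hT, h1, h2, h3⟩
    rw [hrow hT] at h2
    refine ⟨fun i => ?_, fun b b' hb hr hc => ?_, fun b b' hb hr hc => ?_⟩
    · induction i using Fin.lastCases with
      | last => rw [Box.diag_last]; exact h1
      | cast i => rw [Box.diag_castSucc]; exact hT.1 i
    · rcases Box.shift_or_first b with ⟨b, rfl⟩ | ⟨i, rfl⟩ <;>
      rcases Box.shift_or_first b' with ⟨b', rfl⟩ | ⟨i', rfl⟩
      · exact hT.2.1 b b' hb (by simpa using hr) (by simpa using hc)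
      · exact h2 i' b (by simpa using hr.symm) hb
      · simp at hc
      · simp at hc
    · rcases Box.shift_or_first b with ⟨b, rfl⟩ | ⟨i, rfl⟩ <;>
      rcases Box.shift_or_first b' with ⟨b', rfl⟩ | ⟨i', rfl⟩
      · exact hT.2.2 b b' hb (by simpa using hr) (by simpa using hc)
      · exact absurd hr.symm (Fin.succ_ne_zero _)
      · exact absurd hr (Fin.succ_ne_zero _)
      · exact h3 i i' hb hc

/-! ### Factorization of the weight over columns, and of a column over its boxes. -/

section Contribution

variable {R : Type*} [CommSemiring R]

/-- The weight at `q = 0` of a box with content `x` that sees the content `r` to its right and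
`d` below. -/
def entryWeight (R : Type*) [CommSemiring R] (r x d : Option Label) : R :=
  match x with
  | some _ => 1
  | none =>
    if r = some Label.be then 1
    else if r = some Label.de then 0
    else if (r = some Label.al ∨ r = some Label.ga) ∧
        (d = some Label.al ∨ d = some Label.de) then 1
    else if (r = some Label.al ∨ r = some Label.ga) ∧
        (d = some Label.be ∨ d = some Label.ga) then 0
    else 1

/-- The fugacity of the content of a diagonal box. -/
def diagWeight (y : R) (x : Option Label) : R :=
  if x = some Label.al ∨ x = some Label.de then y else 1

theorem boxWeight_first {n : ℕ} (T : Filling (n + 1)) (i : Fin (n + 1)) :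
    boxWeight T (1 : R) 1 1 1 0 1 (Box.first i) =
      entryWeight R (extendLead (lead (restrict T)) i) (firstCol T i)
        (belowLabel (firstCol T) i) := by
  unfold boxWeight entryWeight blankWeight
  simp only [seesRight_first, seesBelow_first]
  rw [firstCol]
  rcases T (Box.first i) with _ | _ | _ | _ | _ <;> rfl

theorem boxWeight_shift {n : ℕ} (T : Filling (n + 1)) (b : Box n) :
    boxWeight T (1 : R) 1 1 1 0 1 b.shift = boxWeight (restrict T) (1 : R) 1 1 1 0 1 b := by
  unfold boxWeight blankWeight
  simp only [seesRight_shift, seesBelow_shift]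
  rfl

/-- The contribution of a filling to the partition function at `q = 0`. -/
def contribution (y : R) {n : ℕ} (T : Filling n) : R :=
  if IsStaircaseTableau T then
    (∏ b : Box n, boxWeight T 1 1 1 1 0 1 b) * ∏ i : Fin n, diagWeight y (T (Box.diag i))
  else 0

theorem fugacityZ_eq_sum_contribution (n : ℕ) (y : R) :
    fugacityZ n y 1 1 1 1 0 = ∑ T : Filling n, contribution y T := by
  simp only [contribution]
  rw [← Finset.sum_filter, fugacityZ, Finset.sum_subtype (f := fun T : Filling n =>
    (∏ b : Box n, boxWeight T (1 : R) 1 1 1 0 1 b) * ∏ i : Fin n, diagWeight y (T (Box.diag i)))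
    (p := IsStaircaseTableau) _ (fun T => by simp)]
  refine Finset.sum_congr rfl fun T _ => ?_
  simp only [diagWeight, weight, particleCount, tableauType, decide_eq_true_eq]
  rw [Finset.prod_ite, Finset.prod_const, Finset.prod_const_one, mul_one]

open Classical in
/-- The factor that a first column with labels `c` contributes when it is added to rows with
leading labels `s`. -/
noncomputable def columnWeight (y : R) {n : ℕ} (s : Fin n → Option Label)
    (c : Fin (n + 1) → Option Label) : R :=
  if ColumnFits s c then
    (∏ i, entryWeight R (extendLead s i) (c i) (belowLabel c i)) * diagWeight y (c (Fin.last n))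
  else 0

theorem contribution_succ (y : R) {n : ℕ} (T : Filling (n + 1)) :
    contribution y T =
      contribution y (restrict T) * columnWeight y (lead (restrict T)) (firstCol T) := by
  have hprod : ∏ b, boxWeight T (1 : R) 1 1 1 0 1 b =
      (∏ b, boxWeight (restrict T) (1 : R) 1 1 1 0 1 b) *
      ∏ i, entryWeight R (extendLead (lead (restrict T)) i) (firstCol T i)
        (belowLabel (firstCol T) i) := by
    rw [← Equiv.prod_comp (Box.splitEquiv n), Fintype.prod_sum_type]
    simp only [← boxWeight_first, ← boxWeight_shift]
    rfl
  have hiff := isStaircaseTableau_succ_iff T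
  unfold contribution columnWeight
  by_cases hT : IsStaircaseTableau T
  · obtain ⟨h1, h2⟩ := hiff.1 hT
    rw [if_pos hT, if_pos h1, if_pos h2, hprod,
      Fin.prod_univ_castSucc (fun i => diagWeight y (T (Box.diag i))), Box.diag_last]
    simp only [Box.diag_castSucc, restrict, firstCol]
    ring
  · rw [if_neg hT]
    by_cases h1 : IsStaircaseTableau (restrict T)
    · rw [if_neg fun h2 => hT (hiff.2 ⟨h1, h2⟩), mul_zero]
    · rw [if_neg h1, zero_mul]

/-- The factor contributed by the topmost box of a column, with content `x`, in a row with leading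
label `r`, where `d` is the topmost label of the rest of the column. -/
def topWeight (R : Type*) [CommSemiring R] (r x d : Option Label) : R :=
  if ((r = some Label.be ∨ r = some Label.de) → x = none) ∧
    ((d = some Label.al ∨ d = some Label.ga) → x = none) then entryWeight R r x d else 0

theorem columnWeight_zero (y : R) (s : Fin 0 → Option Label) (c : Fin 1 → Option Label) :
    columnWeight y s c = if c 0 = none then 0 else diagWeight y (c 0) := by
  have hs : extendLead s 0 = none := by simp [extendLead]
  have : ColumnFits s c ↔ c 0 ≠ none := by
    simp [ColumnFits, hs]
  rw [columnWeight, this]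
  cases h : c 0 <;> simp [entryWeight, h]

/-- Boxes above an `α` or `γ` are empty, so such a label can only be the topmost one of its column.
A box put on top therefore needs to know only the topmost label beneath it. -/
theorem columnFits_cons {n : ℕ} (s : Fin n → Option Label) (c : Fin (n + 1) → Option Label)
    (r x : Option Label) :
    ColumnFits (Fin.cons r s : Fin (n + 1) → Option Label)
      (Fin.cons x c : Fin (n + 2) → Option Label) ↔
    (((r = some Label.be ∨ r = some Label.de) → x = none) ∧
      ((topLabel c = some Label.al ∨ topLabel c = some Label.ga) → x = none)) ∧
      ColumnFits s c := by
  have hl : (Fin.cons x c : Fin (n + 2) → Option Label) (Fin.last (n + 1)) = c (Fin.last n) := by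
    rw [← Fin.succ_last, Fin.cons_succ]
  have key : (∀ i j, (c i = some Label.al ∨ c i = some Label.ga) → j < i → c j = none) →
      ((topLabel c = some Label.al ∨ topLabel c = some Label.ga) ↔
        ∃ i, c i = some Label.al ∨ c i = some Label.ga) := by
    intro h
    simp only [topLabel_eq_some_iff]
    constructor
    · rintro (⟨i, hi, -⟩ | ⟨i, hi, -⟩)
      exacts [⟨i, Or.inl hi⟩, ⟨i, Or.inr hi⟩]
    · rintro ⟨i, hi⟩
      have := fun k hk => h i k hi hk
      rcases hi with hi | hi
      exacts [Or.inl ⟨i, hi, this⟩, Or.inr ⟨i, hi, this⟩]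
  unfold ColumnFits
  simp only [hl]
  rw [Fin.forall_fin_succ (P := fun i => (_ ∨ _) → _),
    Fin.forall_fin_succ (P := fun i => ∀ j, (_ ∨ _) → _ → _)]
  simp only [Fin.forall_fin_succ (n := n + 1), Fin.cons_zero, Fin.cons_succ, extendLead_zero,
    extendLead_succ, Fin.succ_lt_succ_iff, Fin.not_lt_zero, Fin.succ_pos, false_imp_iff,
    true_imp_iff, imp_true_iff, forall_and, true_and]
  by_cases h : ∀ i j, (c i = some Label.al ∨ c i = some Label.ga) → j < i → c j = none
  · rw [key h]
    simp only [forall_exists_index]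
    tauto
  · simp only [h, and_false]

/-- Boxes look only right and down, so a box added on top leaves all other weights unchanged. This
permits induction over the rows from bottom to top. -/
theorem columnWeight_cons (y : R) {n : ℕ} (s : Fin n → Option Label)
    (c : Fin (n + 1) → Option Label) (r x : Option Label) :
    columnWeight y (Fin.cons r s : Fin (n + 1) → Option Label)
      (Fin.cons x c : Fin (n + 2) → Option Label) =
    topWeight R r x (topLabel c) * columnWeight y s c := by
  have hl : (Fin.cons x c : Fin (n + 2) → Option Label) (Fin.last (n + 1)) = c (Fin.last n) := by
    rw [← Fin.succ_last, Fin.cons_succ]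
  rw [columnWeight, columnWeight, topWeight, columnFits_cons, Fin.prod_univ_succ]
  simp only [hl, Fin.cons_zero, Fin.cons_succ, extendLead_zero, extendLead_succ, belowLabel,
    Fin.cases_zero, Fin.cases_succ]
  split_ifs <;> first | simp_all; done | ring

end Contribution

/-! ### Sums over columns with a given topmost label. -/

theorem Label.sum_univ {M : Type*} [AddCommMonoid M] (f : Label → M) :
    ∑ l, f l = f .al + f .be + f .ga + f .de := by
  change ∑ l ∈ ({Label.al, Label.be, Label.ga, Label.de} : Finset Label), f l = _
  simp [add_assoc]

theorem topLabel_cons {n : ℕ} (x : Option Label) (c : Fin n → Option Label) :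
    topLabel (Fin.cons x c : Fin (n + 1) → Option Label) = x.or (topLabel c) := by
  simp [topLabel]

theorem eq_none_of_topLabel_eq_none {n : ℕ} {c : Fin n → Option Label} (h : topLabel c = none)
    (i : Fin n) : c i = none := by
  induction n with
  | zero => exact i.elim0
  | succ n ih =>
    rw [topLabel, Option.or_eq_none_iff] at h
    induction i using Fin.cases with
    | zero => exact h.1
    | succ i => exact ih h.2 i

/-- The number of rows whose leading label is `α` or `γ`. -/
def openCount {n : ℕ} (s : Fin n → Option Label) : ℕ :=
  ∑ i, if s i = some Label.al ∨ s i = some Label.ga then 1 else 0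

theorem openCount_cons {n : ℕ} (r : Option Label) (s : Fin n → Option Label) :
    openCount (Fin.cons r s : Fin (n + 1) → Option Label) =
      (if r = some Label.al ∨ r = some Label.ga then 1 else 0) + openCount s := by
  rw [openCount, Fin.sum_univ_succ]
  simp only [Fin.cons_zero, Fin.cons_succ]
  rfl

section

variable {R : Type*} [CommSemiring R]

/-- The function of leading labels that is `v` of the number of open rows if no leading label is
`δ`, and `0` otherwise. -/
def openTest (v : ℕ → R) {n : ℕ} (s : Fin n → Option Label) : R :=
  if ∀ i, s i ≠ some Label.de then v (openCount s) else 0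

theorem openTest_be (v : ℕ → R) {n : ℕ} (s : Fin n → Option Label) :
    openTest v (Fin.cons (some Label.be) s : Fin (n + 1) → Option Label) = openTest v s := by
  simp [openTest, openCount_cons, Fin.forall_fin_succ]

theorem openTest_de (v : ℕ → R) {n : ℕ} (s : Fin n → Option Label) :
    openTest v (Fin.cons (some Label.de) s : Fin (n + 1) → Option Label) = 0 := by
  simp [openTest, Fin.forall_fin_succ]

theorem openTest_open (v : ℕ → R) {n : ℕ} (s : Fin n → Option Label) {l : Label}
    (hl : l = .al ∨ l = .ga) :
    openTest v (Fin.cons (some l) s : Fin (n + 1) → Option Label) =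
      openTest (fun k => v (k + 1)) s := by
  rcases hl with rfl | rfl <;>
    simp [openTest, openCount_cons, Fin.forall_fin_succ, add_comm]

/-- The sum over all columns with topmost label `l`, added to rows with leading labels `s`, of the
column weight times a function `E` of the new leading labels. -/
noncomputable def columnSum (y : R) {n : ℕ} (s : Fin n → Option Label) (l : Label)
    (E : (Fin (n + 1) → Option Label) → R) : R :=
  ∑ c : Fin (n + 1) → Option Label,
    if topLabel c = some l then columnWeight y s c * E (newLead s c) else 0

/-- The bottom box of the column lies on the diagonal and cannot be empty. -/
theorem columnWeight_eq_zero (y : R) {n : ℕ} (s : Fin n → Option Label)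
    {c : Fin (n + 1) → Option Label} (h : topLabel c = none) : columnWeight y s c = 0 :=
  if_neg fun hc => hc.1 (eq_none_of_topLabel_eq_none h _)

theorem sum_columnSum (y : R) {n : ℕ} (s : Fin n → Option Label)
    (E : (Fin (n + 1) → Option Label) → R) :
    ∑ c, columnWeight y s c * E (newLead s c) = ∑ l, columnSum y s l E := by
  unfold columnSum
  rw [Finset.sum_comm]
  refine Finset.sum_congr rfl fun c _ => ?_
  cases h : topLabel c with
  | none => simp [columnWeight_eq_zero y s h]
  | some l => simp

theorem columnSum_zero (y : R) (s : Fin 0 → Option Label) (l : Label)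
    (E : (Fin 1 → Option Label) → R) :
    columnSum y s l E = diagWeight y (some l) * E (fun _ => some l) := by
  have hn (x : Option Label) : newLead s (fun _ => x) = fun _ => x := by
    funext i
    simp [newLead, extendLead]
  have hf (x : Option Label) : (Equiv.funUnique (Fin 1) (Option Label)).symm x = fun _ => x := rfl
  rw [columnSum, ← Equiv.sum_comp (Equiv.funUnique (Fin 1) (Option Label)).symm]
  simp only [columnWeight_zero, topLabel, hf, hn]
  rw [Fintype.sum_option]
  simp

theorem columnSum_cons (y : R) {n : ℕ} (r : Option Label) (s : Fin n → Option Label) (l : Label)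
    (E : (Fin (n + 2) → Option Label) → R) :
    columnSum y (Fin.cons r s : Fin (n + 1) → Option Label) l E =
      ∑ c : Fin (n + 1) → Option Label,
        ((if topLabel c = some l then topWeight R r none (some l) * columnWeight y s c *
          E (Fin.cons r (newLead s c)) else 0) +
        topWeight R r (some l) (topLabel c) * columnWeight y s c *
          E (Fin.cons (some l) (newLead s c))) := by
  rw [columnSum, ← Equiv.sum_comp (Fin.consEquiv fun _ => Option Label), Fintype.sum_prod_type_right]
  refine Finset.sum_congr rfl fun c _ => ?_
  have hc (x : Option Label) : (Fin.consEquiv fun _ => Option Label) (x, c) =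
    (Fin.cons x c : Fin (n + 2) → Option Label) := rfl
  simp only [hc, columnWeight_cons, newLead_cons, topLabel_cons]
  rw [Fintype.sum_option]
  congr 1
  · simp only [Option.none_or]
    split_ifs with h
    · simp [h]
    · simp [h]
  · simp

theorem columnSum_be (y : R) {n : ℕ} (s : Fin n → Option Label) (l : Label)
    (E : (Fin (n + 2) → Option Label) → R) :
    columnSum y (Fin.cons (some Label.be) s : Fin (n + 1) → Option Label) l E =
      columnSum y s l fun L => E (Fin.cons (some Label.be) L) := by
  rw [columnSum_cons]
  simp [columnSum, topWeight, entryWeight]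

theorem columnSum_de (y : R) {n : ℕ} (s : Fin n → Option Label) (l : Label)
    (E : (Fin (n + 2) → Option Label) → R) :
    columnSum y (Fin.cons (some Label.de) s : Fin (n + 1) → Option Label) l E = 0 := by
  rw [columnSum_cons]
  simp [topWeight, entryWeight]

/-- If the top box is empty, it has weight `1` above `α` or `δ` and `q = 0` above `β` or `γ`. If it
carries `l`, the topmost label beneath must be `β` or `δ`. -/
theorem columnSum_open (y : R) {n : ℕ} (s : Fin n → Option Label) (l : Label) {r : Label}
    (hr : r = .al ∨ r = .ga) (E : (Fin (n + 2) → Option Label) → R) :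
    columnSum y (Fin.cons (some r) s : Fin (n + 1) → Option Label) l E =
      (if l = .al ∨ l = .de then columnSum y s l fun L => E (Fin.cons (some r) L) else 0) +
      ((columnSum y s .be fun L => E (Fin.cons (some l) L)) +
        columnSum y s .de fun L => E (Fin.cons (some l) L)) := by
  rw [columnSum_cons, Finset.sum_add_distrib]
  congr 1
  · unfold columnSum
    split_ifs with hl
    · refine Finset.sum_congr rfl fun c _ => ?_
      have : topWeight R (some r) none (some l) = 1 := by
        rcases hr with rfl | rfl <;> rcases hl with rfl | rfl <;> simp [topWeight, entryWeight]
      rw [this, one_mul]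
    · refine Finset.sum_eq_zero fun c _ => ?_
      have : topWeight R (some r) none (some l) = 0 := by
        rcases hr with rfl | rfl <;> cases l <;> simp [topWeight, entryWeight] at hl ⊢
      simp [this]
  · unfold columnSum
    rw [← Finset.sum_add_distrib]
    refine Finset.sum_congr rfl fun c _ => ?_
    cases h : topLabel c with
    | none => simp [columnWeight_eq_zero y s h]
    | some d =>
      rcases hr with rfl | rfl <;> cases d <;> simp [topWeight, entryWeight]

/-- The total weight of columns with topmost label `l` added to `k` open rows. -/
def columnTotal (y : R) (l : Label) (k : ℕ) : R :=
  match l, k with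
  | .al, k | .de, k => Nat.fib (2 * k) + y * Nat.fib (2 * k + 1)
  | .be, 0 | .ga, 0 => 1
  | .be, k + 1 | .ga, k + 1 => Nat.fib (2 * k + 1) + y * Nat.fib (2 * k + 2)

/-- Together with `columnTotal_open_succ` this says that the totals for `β` and `δ`, interleaved as
`1, y, 1 + y, 1 + 2y, …`, form a Fibonacci sequence. The separate value at `k = 0` stands for
`F_{-1} = 1`. -/
theorem columnTotal_closed_succ (y : R) (k : ℕ) :
    columnTotal y .be (k + 1) = columnTotal y .be k + columnTotal y .de k := by
  cases k with
  | zero => simp [columnTotal]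
  | succ k =>
    simp only [columnTotal, Nat.mul_succ, Nat.fib_add_two (n := 2 * k + 1),
      Nat.fib_add_two (n := 2 * k + 2)]
    push_cast
    ring

theorem columnTotal_open_succ (y : R) (k : ℕ) :
    columnTotal y .de (k + 1) = columnTotal y .de k + columnTotal y .be (k + 1) := by
  simp only [columnTotal, Nat.mul_succ, Nat.fib_add_two (n := 2 * k),
      Nat.fib_add_two (n := 2 * k + 1)]
  push_cast
  ring

theorem columnTotal_al (y : R) (k : ℕ) : columnTotal y .al k = columnTotal y .de k := by
  cases k <;> rfl

theorem columnTotal_ga (y : R) (k : ℕ) : columnTotal y .ga k = columnTotal y .be k := by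
  cases k <;> rfl

theorem openTest_add (v v' : ℕ → R) {n : ℕ} (s : Fin n → Option Label) :
    openTest v s + openTest v' s = openTest (fun k => v k + v' k) s := by
  unfold openTest
  split_ifs <;> simp

theorem columnSum_one (y : R) {n : ℕ} (s : Fin n → Option Label) (hs : ∀ i, s i ≠ none)
    (l : Label) : columnSum y s l (fun _ => 1) = openTest (columnTotal y l) s := by
  induction n generalizing l with
  | zero =>
    rw [columnSum_zero]
    cases l <;> simp [diagWeight, openTest, openCount, columnTotal]
  | succ n ih =>
    induction s using Fin.consCases with
    | cons r s =>
      rw [Fin.forall_fin_succ] at hs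
      simp only [Fin.cons_zero, Fin.cons_succ] at hs
      obtain ⟨r, rfl⟩ := Option.ne_none_iff_exists'.1 hs.1
      replace ih := ih s hs.2
      have hopen (hr : r = .al ∨ r = .ga) :
          columnSum y (Fin.cons (some r) s : Fin (n + 1) → Option Label) l (fun _ => 1) =
          openTest (columnTotal y l) (Fin.cons (some r) s : Fin (n + 1) → Option Label) := by
        rw [columnSum_open y s l hr, openTest_open _ s hr]
        simp only [ih, openTest_add, ← columnTotal_closed_succ]
        cases l <;>
          simp [openTest_add, columnTotal_al, columnTotal_ga, columnTotal_open_succ]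
      cases r with
      | be => rw [columnSum_be, openTest_be, ih]
      | de => rw [columnSum_de, openTest_de]
      | al => exact hopen (Or.inl rfl)
      | ga => exact hopen (Or.inr rfl)

/-- The sum, over all columns with topmost label `l` and without `δ` that can be added to `k`
open rows, of the column weight times `v` of the new number of open rows. -/
def columnTransfer (y : R) (v : ℕ → R) (l : Label) (k : ℕ) : R :=
  match l with
  | .al => y * v (k + 1) + ∑ i ∈ Finset.range k, v (i + 1)
  | .be => v 0
  | .ga => v 1
  | .de => 0

theorem columnSum_zero_right (y : R) {n : ℕ} (s : Fin n → Option Label) (l : Label) :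
    columnSum y s l (fun _ => 0) = 0 := by
  simp [columnSum]

theorem openTest_zero {n : ℕ} (s : Fin n → Option Label) :
    openTest (fun _ => (0 : R)) s = 0 := by
  simp [openTest]

/-- Without `δ`, all labels below the topmost one are `β`, and they fill the diagonal box and every
open row beneath it, as an empty box there would have weight `0`. A topmost `β` or `γ` must moreover
lie in the highest available box, leaving `0` or `1` open rows. A topmost `α` may lie in any of the
`k + 1` boxes and keeps the open rows above it; on the diagonal it keeps all `k` and earns the
factor `y`. -/
theorem columnSum_openTest (y : R) {n : ℕ} (s : Fin n → Option Label) (hs : ∀ i, s i ≠ none)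
    (v : ℕ → R) (l : Label) :
    columnSum y s l (openTest v) = openTest (columnTransfer y v l) s := by
  induction n generalizing l v with
  | zero =>
    rw [columnSum_zero]
    cases l <;> simp [diagWeight, openTest, openCount, columnTransfer]
  | succ n ih =>
    induction s using Fin.consCases with
    | cons r s =>
      rw [Fin.forall_fin_succ] at hs
      simp only [Fin.cons_zero, Fin.cons_succ] at hs
      obtain ⟨r, rfl⟩ := Option.ne_none_iff_exists'.1 hs.1
      replace ih := ih s hs.2
      have hopen (hr : r = .al ∨ r = .ga) :
          columnSum y (Fin.cons (some r) s : Fin (n + 1) → Option Label) l (openTest v) =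
          openTest (columnTransfer y v l)
            (Fin.cons (some r) s : Fin (n + 1) → Option Label) := by
        rw [columnSum_open y s l hr, openTest_open _ s hr]
        simp only [openTest_open _ _ hr]
        have hde (v : ℕ → R) : openTest (columnTransfer y v .de) s = 0 := openTest_zero s
        cases l <;>
          simp [openTest_open, openTest_be, openTest_de, ih, openTest_add, columnTransfer,
            columnSum_zero_right, hde, openTest_zero, Finset.sum_range_succ', add_assoc]
        all_goals rfl
      cases r with
      | be => simp only [columnSum_be, openTest_be, ih]
      | de => rw [columnSum_de, openTest_de]
      | al => exact hopen (Or.inl rfl)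
      | ga => exact hopen (Or.inr rfl)

end

/-! ### The transfer operator and the iteration formula for the partition function. -/

section

variable {R : Type*} [CommSemiring R]

/-- The transfer operator that describes the addition of a first column without `δ`. -/
def transfer (y : R) (v : ℕ → R) (k : ℕ) : R :=
  y * v (k + 1) + v 1 + ∑ i ∈ Finset.range (k + 1), v i

theorem sum_openTest (v : Label → ℕ → R) {n : ℕ} (s : Fin n → Option Label) :
    ∑ l, openTest (v l) s = openTest (fun k => ∑ l, v l k) s := by
  unfold openTest
  split_ifs <;> simp

theorem sum_columnWeight_mul_openTest (y : R) {n : ℕ} (s : Fin n → Option Label)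
    (hs : ∀ i, s i ≠ none) (v : ℕ → R) :
    ∑ c, columnWeight y s c * openTest v (newLead s c) = openTest (transfer y v) s := by
  rw [sum_columnSum]
  simp only [columnSum_openTest y s hs, sum_openTest]
  congr 1
  funext k
  rw [Label.sum_univ, transfer, Finset.sum_range_succ']
  simp only [columnTransfer]
  ring

/-- The total weight of all columns that can be added to `k` open rows. -/
def finalTest (y : R) (k : ℕ) : R :=
  2 * (Nat.fib (2 * k + 1) + y * Nat.fib (2 * k + 2))

theorem sum_columnWeight (y : R) {n : ℕ} (s : Fin n → Option Label) (hs : ∀ i, s i ≠ none) :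
    ∑ c, columnWeight y s c = openTest (finalTest y) s := by
  have := sum_columnSum y s fun _ => 1
  simp only [mul_one, columnSum_one y s hs, sum_openTest] at this
  rw [this]
  congr 1
  funext k
  rw [Label.sum_univ, columnTotal_al, columnTotal_ga]
  have := columnTotal_closed_succ y k
  simp only [columnTotal] at this ⊢
  rw [finalTest, this]
  ring

theorem sum_filling_succ {n : ℕ} (F : Filling n → (Fin (n + 1) → Option Label) → R) :
    ∑ T : Filling (n + 1), F (restrict T) (firstCol T) = ∑ T : Filling n, ∑ c, F T c := by
  rw [← Fintype.sum_prod_type', ← Equiv.sum_comp (fillingEquiv n)]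
  rfl

theorem contribution_mul_congr (y : R) {n : ℕ} (T : Filling n) {a b : R}
    (h : (∀ i, lead T i ≠ none) → a = b) : contribution y T * a = contribution y T * b := by
  by_cases hT : IsStaircaseTableau T
  · rw [h (lead_ne_none hT)]
  · simp [contribution, hT]

/-- The operator acts on test functions, so peeling off the leftmost column applies it once to `v`;
the empty tableau has no open rows, whence the argument `0`. -/
theorem sum_contribution_mul_openTest (y : R) (n : ℕ) (v : ℕ → R) :
    ∑ T : Filling n, contribution y T * openTest v (lead T) = (transfer y)^[n] v 0 := by
  induction n generalizing v with
  | zero =>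
    have : IsEmpty (Box 0) := ⟨fun b => b.row.elim0⟩
    simp [contribution, openTest, openCount, IsStaircaseTableau]
  | succ n ih =>
    simp only [contribution_succ, lead]
    rw [sum_filling_succ fun T c => contribution y T * columnWeight y (lead T) c *
      openTest v (newLead (lead T) c), Function.iterate_succ_apply, ← ih]
    refine Finset.sum_congr rfl fun T _ => ?_
    simp only [mul_assoc, ← Finset.mul_sum]
    exact contribution_mul_congr y T fun h => sum_columnWeight_mul_openTest y _ h v

theorem fugacityZ_succ (y : R) (n : ℕ) :
    fugacityZ (n + 1) y 1 1 1 1 0 = (transfer y)^[n] (finalTest y) 0 := by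
  rw [fugacityZ_eq_sum_contribution, ← sum_contribution_mul_openTest]
  simp only [contribution_succ]
  rw [sum_filling_succ fun T c => contribution y T * columnWeight y (lead T) c]
  refine Finset.sum_congr rfl fun T _ => ?_
  rw [← Finset.mul_sum]
  exact contribution_mul_congr y T fun h => sum_columnWeight y _ h

end

/-! ### Solving the functional equation by the kernel method. -/

section GeneratingFunction

open PowerSeries

variable {R : Type*} [CommRing R]

theorem eq_seriesQuot {f g h : PowerSeries R} (hg : constantCoeff g = 1) (e : h * g = f) :
    h = seriesQuot f g := by
  have hi : g * invOfUnit g 1 = 1 := mul_invOfUnit g 1 (by simpa using hg)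
  rw [seriesQuot, ← e, mul_assoc, hi, mul_one]

theorem exists_mul_eq_one {g : PowerSeries R} (hg : constantCoeff g = 1) :
    ∃ i : PowerSeries R, g * i = 1 :=
  ⟨_, mul_invOfUnit g 1 (by simpa using hg)⟩

/-- The series `w` has no constant term, hence the transfer equation has at most one solution. -/
theorem eq_zero_of_eq_transfer {w : PowerSeries R} (hw : X ∣ w) (y : R) (D : ℕ → PowerSeries R)
    (hD : ∀ k, D k = w * (transfer (C y) D k)) (k : ℕ) : D k = 0 := by
  have key : ∀ m k, (X : PowerSeries R) ^ m ∣ D k := by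
    intro m
    induction m with
    | zero => simp
    | succ m ih =>
      intro k
      rw [hD, pow_succ']
      refine mul_dvd_mul hw ?_
      exact dvd_add (dvd_add ((ih _).mul_left _) (ih _)) (Finset.dvd_sum fun i _ => ih i)
  ext m
  exact X_pow_dvd_iff.1 (key (m + 1) k) m (Nat.lt_succ_self m)

theorem subst_transfer {w : PowerSeries R} (hw : HasSubst w) (y : R) (f : ℕ → R) (k : ℕ) :
    (mk fun n => (transfer y)^[n] f k).subst w =
      C (f k) + w * transfer (C y) (fun k => (mk fun n => (transfer y)^[n] f k).subst w) k := by
  have h : (mk fun n => (transfer y)^[n] f k) =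
      C (f k) + X * transfer (C y) (fun k => mk fun n => (transfer y)^[n] f k) k := by
    ext n
    cases n with
    | zero => simp
    | succ n =>
      rw [coeff_mk, Function.iterate_succ_apply', map_add, coeff_succ_X_mul]
      simp [transfer]
  rw [h]
  simp only [← coe_substAlgHom hw]
  simp only [transfer, map_add, map_mul, map_sum]
  simp only [coe_substAlgHom hw, subst_X hw]
  have hC (r : R) : (C r).subst w = C r := subst_C r
  simp only [hC]

theorem sum_fib_odd (k : ℕ) :
    ∑ i ∈ Finset.range (k + 1), Nat.fib (2 * i + 1) = Nat.fib (2 * k + 2) := by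
  induction k with
  | zero => simp
  | succ k ih => rw [Finset.sum_range_succ, ih]; exact (Nat.fib_add_two (n := 2 * k + 2)).symm

theorem sum_fib_even (k : ℕ) :
    ∑ i ∈ Finset.range (k + 1), Nat.fib (2 * i + 2) + 1 = Nat.fib (2 * k + 3) := by
  induction k with
  | zero => rfl
  | succ k ih =>
    rw [Finset.sum_range_succ, add_right_comm, ih]
    exact (Nat.fib_add_two (n := 2 * k + 3)).symm

/-- The functions `F_{2k+1}`, `F_{2k+2}`, `(1 + X)^k` and the constants span a space stable under
`transfer`. The constants are the only obstruction to the ansatz, and `c` is chosen to cancel them.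
-/
theorem transfer_explicit (y a b c : PowerSeries R) (k : ℕ) :
    X * transfer y (fun k => a * (Nat.fib (2 * k + 1) : PowerSeries R) +
        b * (Nat.fib (2 * k + 2) : PowerSeries R) + c * (1 + X) ^ k) k =
      X * ((y * a + (y + 1) * b) * (Nat.fib (2 * k + 1) : PowerSeries R) +
        ((y + 1) * a + (2 * y + 1) * b) * (Nat.fib (2 * k + 2) : PowerSeries R)) +
      c * (1 + y * X) * (1 + X) ^ (k + 1) + 2 * X * (a + b) - c * (1 - X - X ^ 2) := by
  have h1 : (∑ i ∈ Finset.range (k + 1), (Nat.fib (2 * i + 1) : PowerSeries R)) =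
      Nat.fib (2 * k + 2) := by exact_mod_cast congrArg Nat.cast (sum_fib_odd k)
  have h2 : (∑ i ∈ Finset.range (k + 1), (Nat.fib (2 * i + 2) : PowerSeries R)) =
      Nat.fib (2 * k + 1) + Nat.fib (2 * k + 2) - 1 := by
    rw [eq_sub_iff_add_eq]
    have := congrArg (Nat.cast (R := PowerSeries R)) (sum_fib_even k)
    rw [Nat.fib_add_two] at this
    exact_mod_cast this
  have h3 : X * (∑ i ∈ Finset.range (k + 1), (1 + X : PowerSeries R) ^ i) =
      (1 + X) ^ (k + 1) - 1 := by
    have := mul_geom_sum (1 + X : PowerSeries R) (k + 1)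
    rwa [add_sub_cancel_left] at this
  have h4 : (Nat.fib (2 * (k + 1) + 1) : PowerSeries R) =
      Nat.fib (2 * k + 1) + Nat.fib (2 * k + 2) := by
    exact_mod_cast congrArg Nat.cast (Nat.fib_add_two (n := 2 * k + 1))
  have h5 : (Nat.fib (2 * (k + 1) + 2) : PowerSeries R) =
      Nat.fib (2 * k + 1) + 2 * Nat.fib (2 * k + 2) := by
    have := congrArg (Nat.cast (R := PowerSeries R)) (Nat.fib_add_two (n := 2 * (k + 1)))
    push_cast at this
    rw [this, h4, show 2 * (k + 1) = 2 * k + 2 by ring]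
    ring
  have f3 : Nat.fib 3 = 2 := rfl
  have f4 : Nat.fib 4 = 3 := rfl
  simp only [transfer, Finset.sum_add_distrib, ← Finset.mul_sum, h1, h2, h4, h5, mul_one,
    Nat.reduceAdd, f3, f4]
  push_cast
  linear_combination c * h3

theorem subst_iterate_transfer {w : PowerSeries R} (y : R)
    (hw : w * ((1 + X) * (1 + C y * X)) = X) :
    (mk fun n => (transfer y)^[n] (finalTest y) 0).subst w *
      ((1 - X - X ^ 2) * (1 - C y * X - C y ^ 2 * X ^ 2)) =
      2 * (1 + C y) * ((1 + X) * (1 + C y * X)) ^ 2 := by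
  obtain ⟨p, hp⟩ := exists_mul_eq_one (g := (1 + X) * (1 + C y * X)) (by simp)
  obtain ⟨i, hi⟩ := exists_mul_eq_one (g := (1 + X - X ^ 2 : PowerSeries R)) (by simp)
  obtain ⟨j, hj⟩ := exists_mul_eq_one (g := 1 - C y * X - C y ^ 2 * X ^ 2) (by simp)
  obtain ⟨l, hl⟩ := exists_mul_eq_one (g := (1 - X - X ^ 2 : PowerSeries R)) (by simp)
  have hwp : w = X * p := by linear_combination p * hw - w * hp
  have hws : HasSubst w := HasSubst.of_constantCoeff_zero' (by simp [hwp])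
  set z : PowerSeries R := C y with hz
  -- Cramer's rule for the linear system `ea`, `eb` that compares coefficients of the two Fibonacci
  -- functions. Its determinant times `((1 + X) * (1 + z * X)) ^ 2` is `(1 + X - X ^ 2) * (1 - z * X
  -- - z ^ 2 * X ^ 2)`.
  set a := 2 * ((1 + X) * (1 + z * X)) * (1 + z ^ 2 * X + z * X ^ 2) * (i * j) with ha
  set b := 2 * ((1 + X) * (1 + z * X)) * (z + (2 * z + 1) * X + z ^ 2 * X ^ 2) * (i * j) with hb
  set c := 2 * X * (a + b) * l with hc
  have hij : (1 + X - X ^ 2) * (1 - z * X - z ^ 2 * X ^ 2) * (i * j) = 1 := by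
    linear_combination (1 - z * X - z ^ 2 * X ^ 2) * j * hi + hj
  have ea : a = 2 + w * (z * a + (z + 1) * b) := by
    rw [ha, hb]
    linear_combination 2 * hij - 2 * (i * j) * (z * (1 + z ^ 2 * X + z * X ^ 2) +
      (z + 1) * (z + (2 * z + 1) * X + z ^ 2 * X ^ 2)) * hw
  have eb : b = 2 * z + w * ((z + 1) * a + (2 * z + 1) * b) := by
    rw [ha, hb]
    linear_combination 2 * z * hij - 2 * (i * j) * ((z + 1) * (1 + z ^ 2 * X + z * X ^ 2) +
      (2 * z + 1) * (z + (2 * z + 1) * X + z ^ 2 * X ^ 2)) * hw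
  have ec : c * (1 - X - X ^ 2) = 2 * X * (a + b) := by
    rw [hc]
    linear_combination 2 * X * (a + b) * hl
  have hab : a + b = 2 * (1 + z) * ((1 + X) * (1 + z * X)) ^ 2 * (i * j) := by
    rw [ha, hb]; ring
  clear_value a b c
  let G : ℕ → PowerSeries R := fun k =>
    a * (Nat.fib (2 * k + 1) : PowerSeries R) + b * (Nat.fib (2 * k + 2) : PowerSeries R) +
      c * (1 + X) ^ k
  have hG (k : ℕ) : G k = C (finalTest y k) + w * transfer z G k := by
    have h1 := transfer_explicit z a b c k
    have h2 : C (finalTest y k) = 2 * (Nat.fib (2 * k + 1) + z * Nat.fib (2 * k + 2)) := by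
      simp only [finalTest, hz, map_mul, map_add, map_natCast, map_ofNat]
    rw [h2]
    have h3 : w * transfer z G k = p * (X * transfer z G k) := by rw [hwp]; ring
    rw [h3, h1]
    simp only [G]
    rw [hwp] at ea eb
    linear_combination Nat.fib (2 * k + 1) * ea + Nat.fib (2 * k + 2) * eb
      - c * (1 + X) ^ k * hp + p * ec
  have huniq := eq_zero_of_eq_transfer (w := w) ⟨p, hwp⟩ y
    (fun k => (mk fun n => (transfer y)^[n] (finalTest y) k).subst w - G k) (fun k => by
      rw [subst_transfer hws, hG]
      simp only [transfer, Finset.sum_sub_distrib]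
      ring) 0
  rw [sub_eq_zero.1 huniq]
  simp only [G, mul_zero, zero_add, Nat.fib_one, Nat.fib_two, Nat.cast_one, pow_zero, mul_one]
  -- By `ec`, `(a + b + c) * (1 - X - X ^ 2) = (a + b) * (1 + X - X ^ 2)`, so the spurious factor `1
  -- + X - X ^ 2` of the determinant cancels.
  linear_combination (1 - z * X - z ^ 2 * X ^ 2) * ec + (1 + X - X ^ 2) *
    (1 - z * X - z ^ 2 * X ^ 2) * hab + 2 * (1 + z) * ((1 + X) * (1 + z * X)) ^ 2 * hij

end GeneratingFunction

/-! ### The series identity, and the Fibonacci numbers at `y = 0`. -/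

section FugacitySeries

open PowerSeries

variable {R : Type*} [CommRing R]

theorem seriesQuot_X_mul (y : R) :
    seriesQuot X ((1 + X) * (1 + C y * X)) * ((1 + X) * (1 + C y * X)) = X :=
  seriesQuot_mul _ _ (by simp)

theorem hasSubst_of_mul_eq_X {w g : PowerSeries R} (hg : constantCoeff g = 1) (hw : w * g = X) :
    HasSubst w := by
  refine HasSubst.of_constantCoeff_zero' ?_
  have := congrArg constantCoeff hw
  simpa [hg] using this

/-- The generating function of the partition functions of staircase tableaux of size at
least `1`. -/
noncomputable def fugacitySeries (y : R) : PowerSeries R :=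
  mk fun n => if 1 ≤ n then fugacityZ n y 1 1 1 1 0 else 0

theorem fugacitySeries_eq (y : R) :
    fugacitySeries y = X * mk fun n => (transfer y)^[n] (finalTest y) 0 := by
  ext n
  cases n with
  | zero => simp [fugacitySeries]
  | succ n => simp [fugacitySeries, coeff_succ_X_mul, fugacityZ_succ]

theorem subst_fugacitySeries_mul (y : R) {w : PowerSeries R}
    (hw : w * ((1 + X) * (1 + C y * X)) = X) :
    (fugacitySeries y).subst w * ((1 - X - X ^ 2) * (1 - C y * X - C y ^ 2 * X ^ 2)) =
      2 * (1 + C y) * X * (1 + X) * (1 + C y * X) := by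
  have hs : HasSubst w := hasSubst_of_mul_eq_X (by simp) hw
  rw [fugacitySeries_eq, subst_mul hs, subst_X hs, mul_assoc, subst_iterate_transfer y hw]
  linear_combination 2 * (1 + C y) * ((1 + X) * (1 + C y * X)) * hw

/-- The power series argument needs subtraction, hence runs over `ℤ`; the iteration formula commutes
with the cast. -/
theorem natCast_fugacityZ_zero (n : ℕ) :
    ((fugacityZ (n + 1) (0 : ℕ) 1 1 1 1 0 : ℕ) : ℤ) = fugacityZ (n + 1) (0 : ℤ) 1 1 1 1 0 := by
  have h : Function.Semiconj (fun (v : ℕ → ℕ) k => (v k : ℤ)) (transfer 0) (transfer 0) := by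
    intro v
    funext k
    simp [transfer]
  rw [fugacityZ_succ, fugacityZ_succ]
  refine (congrFun (h.iterate_right n (finalTest 0)) 0).trans ?_
  congr 1

theorem mk_fib_two_mul :
    (mk fun n => (2 * Nat.fib (2 * n) : ℤ)) * (1 - 3 * X + X ^ 2) = 2 * X := by
  set S : PowerSeries ℤ := mk fun n => (2 * Nat.fib (2 * n) : ℤ) with hS
  have h : S * (1 - 3 * X + X ^ 2) = S - X * (3 * S) + X * (X * S) := by ring
  have h3 (n : ℕ) : coeff n (3 * S) = 3 * coeff n S := by
    rw [show (3 : PowerSeries ℤ) = C 3 from rfl, coeff_C_mul]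
  have h2 (n : ℕ) : coeff n (2 * X : PowerSeries ℤ) = 2 * coeff n X := by
    rw [show (2 : PowerSeries ℤ) = C 2 from rfl, coeff_C_mul]
  rw [h]
  ext n
  rw [h2, map_add, map_sub]
  rcases n with _ | _ | n
  · simp [hS]
  · simp only [coeff_succ_X_mul, h3]
    simp [hS]
  · have e1 : Nat.fib (2 * n + 2) = Nat.fib (2 * n) + Nat.fib (2 * n + 1) := Nat.fib_add_two
    have e2 : Nat.fib (2 * n + 3) = Nat.fib (2 * n + 1) + Nat.fib (2 * n + 2) := Nat.fib_add_two
    have e3 : Nat.fib (2 * n + 4) = Nat.fib (2 * n + 2) + Nat.fib (2 * n + 3) := Nat.fib_add_two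
    have hc (m : ℕ) : coeff m S = 2 * Nat.fib (2 * m) := coeff_mk _ _
    simp only [coeff_succ_X_mul, h3, hc, coeff_X]
    rw [if_neg (by omega), show 2 * (n + 1 + 1) = 2 * n + 4 by ring,
      show 2 * (n + 1) = 2 * n + 2 by ring]
    omega

theorem fugacitySeries_zero :
    fugacitySeries (0 : ℤ) = mk fun n => (2 * Nat.fib (2 * n) : ℤ) := by
  set w : PowerSeries ℤ := seriesQuot X ((1 + X) * (1 + C 0 * X)) with hw
  have hwP : w * ((1 + X) * (1 + C 0 * X)) = X := seriesQuot_X_mul 0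
  have hws : HasSubst w := hasSubst_of_mul_eq_X (by simp) hwP
  have h1 := subst_fugacitySeries_mul (0 : ℤ) hwP
  have hF := congrArg (substAlgHom hws) mk_fib_two_mul
  simp only [map_mul, map_add, map_sub, map_pow, map_one, map_ofNat, coe_substAlgHom,
    subst_X hws] at hF
  simp only [map_zero, zero_mul, add_zero, mul_one, ne_eq, OfNat.ofNat_ne_zero,
    not_false_eq_true, zero_pow, sub_zero] at hwP h1
  have hsub : (fugacitySeries (0 : ℤ)).subst w =
      (mk fun n => (2 * Nat.fib (2 * n) : ℤ)).subst w := by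
    obtain ⟨l, hl⟩ := exists_mul_eq_one (g := (1 - X - X ^ 2 : PowerSeries ℤ)) (by simp)
    generalize (fugacitySeries (0 : ℤ)).subst w = A at *
    generalize (mk fun n => (2 * Nat.fib (2 * n) : ℤ)).subst w = B at *
    -- With `w = X / (1 + X)`, clearing denominators in `1 - 3w + w ^ 2` leaves `1 - X - X ^ 2`.
    have h2 : B * (1 - X - X ^ 2) = 2 * X * (1 + X) := by
      linear_combination (1 + X) ^ 2 * hF + (2 * (1 + X) + 3 * B * (1 + X)
        - B * (w * (1 + X) + X)) * hwP
    linear_combination l * (h1 - h2) - (A - B) * hl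
  -- `v` is the compositional inverse of `w`, so substituting it removes `w` from both sides.
  set v : PowerSeries ℤ := seriesQuot X (1 - X) with hv
  have hvX : v * (1 - X) = X := seriesQuot_mul _ _ (by simp)
  have hvs : HasSubst v := hasSubst_of_mul_eq_X (by simp) hvX
  have hwv : PowerSeries.subst v w = X := by
    have := congrArg (substAlgHom hvs) hwP
    simp only [map_mul, map_add, map_one, coe_substAlgHom, subst_X hvs] at this
    linear_combination (1 - X) * this + (1 - PowerSeries.subst v w) * hvX
  have := congrArg (PowerSeries.subst v) hsub
  simpa only [subst_comp_subst_apply hws hvs, hwv, X_subst] using this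

theorem fugacityZ_zero_eq_fib {n : ℕ} (hn : 1 ≤ n) :
    fugacityZ n (0 : ℕ) 1 1 1 1 0 = 2 * Nat.fib (2 * n) := by
  have h := congrArg (coeff n) fugacitySeries_zero
  rw [fugacitySeries, coeff_mk, coeff_mk, if_pos hn] at h
  obtain ⟨n, rfl⟩ := Nat.exists_eq_succ_of_ne_zero (Nat.one_le_iff_ne_zero.1 hn)
  rw [Nat.succ_eq_add_one] at h ⊢
  rw [← natCast_fugacityZ_zero] at h
  exact_mod_cast h

end FugacitySeries

open PowerSeries in
/-- `y` is an arbitrary element of an arbitrary commutative ring `R`; taking `R = ℤ[y]` gives the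
identity with `y` an indeterminate. The variable `t` is `X : R⟦X⟧`. -/
theorem corollary3p10 {R : Type*} [CommRing R] (y : R) (w : PowerSeries R)
    (hw : w = seriesQuot X ((1 + X) * (1 + C y * X))) :
    PowerSeries.HasSubst w ∧
    (PowerSeries.mk fun n => if 1 ≤ n then fugacityZ n y 1 1 1 1 0 else 0).subst w =
      seriesQuot (2 * (1 + C y) * X * (1 + X) * (1 + C y * X))
        ((1 - X - X ^ 2) * (1 - C y * X - C y ^ 2 * X ^ 2)) ∧
    ∀ n : ℕ, 1 ≤ n → fugacityZ n (0 : ℕ) 1 1 1 1 0 = 2 * Nat.fib (2 * n) := by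
  have hwP : w * ((1 + X) * (1 + C y * X)) = X := hw ▸ seriesQuot_X_mul y
  exact ⟨hasSubst_of_mul_eq_X (by simp) hwP,
    eq_seriesQuot (by simp) (subst_fugacitySeries_mul y hwP), fun _ hn => fugacityZ_zero_eq_fib hn⟩
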